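/- Let $f=f_1+if_2$, where $f_1,f_2:\mathbb R\to\mathbb R$ are continuous and $2\pi$-periodic (hence bounded), $f_1$ is positive and even, and $f_2$ is odd. For a continuous $2\pi$-periodic $g:\mathbb R\to\mathbb C$ let $T_n(g)\in\mathbb C^{n\times n}$ be the Toeplitz matrix with entries $T_n(g)_{jk}=\frac1{2\pi}\int_{-\pi}^{\pi}g(x)e^{-i(j-k)x}\,dx$, $1\le j,k\le n$. For degrees $d_1,d_2\ge 0$ let $p_1$ be the even real trigonometric polynomial of degree at most $d_1$ of best uniform approximation of $f_1$ on $[-\pi,\pi]$, let $p_2$ be the odd real trigonometric polynomial of degree at most $d_2$ of best uniform approximation of $f_2$ on $[-\pi,\pi]$, and put $p=p_1+ip_2$. Then for every $\epsilon>0$ there are degrees $d_1,d_2$ such that these best approximations exist, $p_1^2+p_2^2$ has no zero, $T_n(p)$ is invertible for every $n$, and, with $$M=\max_{-\pi\le x\le\pi}\left(\frac1{p_1^2(x)+p_2^2(x)}\right)^{1/2},$$ the interval $[1-M\epsilon,\,1+M\epsilon]$ is a general cluster of the singular values of the matrices $T_n(p)^{-1}T_n(f)$. That is, for every $\delta>0$,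 if $\gamma_n(\delta)$ denotes the number of singular values of $T_n(p)^{-1}T_n(f)$, counted with multiplicity, that lie outside the $\delta$-extension of the interval (the union of the interval with all $\delta$-balls centred at its points), then $\lim_{n\to\infty}\gamma_n(\delta)/n=0$. -/

import Mathlib

open Filter Topology

noncomputable section

/-- The `n × n` Toeplitz matrix generated by `f`: its `(j, k)` entry is the Fourier coefficient
`(1 / 2π) ∫_{-π}^{π} f(x) e^{-i (j - k) x} dx`. -/
def toeplitzMatrix (f : ℝ → ℂ) (n : ℕ) : Matrix (Fin n) (Fin n) ℂ :=
  Matrix.of fun j k =>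
    (1 / (2 * (Real.pi : ℂ))) *
      ∫ x in (-Real.pi)..Real.pi,
        f x * Complex.exp (-Complex.I * (((j : ℕ) : ℂ) - ((k : ℕ) : ℂ)) * (x : ℂ))

/-- `q` is a real trigonometric polynomial of degree at most `d`. -/
def IsTrigPoly (d : ℕ) (q : ℝ → ℝ) : Prop :=
  ∃ a b : ℕ → ℝ, ∀ x : ℝ,
    q x = ∑ k ∈ Finset.range (d + 1), (a k * Real.cos (k * x) + b k * Real.sin (k * x))

/-- The even real trigonometric polynomials of degree at most `d`. -/
def evenTrigPolys (d : ℕ) : Set (ℝ → ℝ) := {q | IsTrigPoly d q ∧ Function.Even q}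

/-- The odd real trigonometric polynomials of degree at most `d`. -/
def oddTrigPolys (d : ℕ) : Set (ℝ → ℝ) := {q | IsTrigPoly d q ∧ Function.Odd q}

/-- The maximal error `sup_{-π ≤ x ≤ π} |g(x) - q(x)|`. -/
def uniformError (g q : ℝ → ℝ) : ℝ :=
  sSup ((fun x => |g x - q x|) '' Set.Icc (-Real.pi) Real.pi)

/-- `q` is a best uniform approximation of `g` on `[-π, π]` from the class `S`. -/
def IsBestUniformApprox (S : Set (ℝ → ℝ)) (g q : ℝ → ℝ) : Prop :=
  q ∈ S ∧ ∀ r ∈ S, uniformError g q ≤ uniformError g r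

/-- The complex function `g₁ + i g₂`. -/
def complexSymbol (g₁ g₂ : ℝ → ℝ) (x : ℝ) : ℂ := (g₁ x : ℂ) + Complex.I * (g₂ x : ℂ)

/-- The number of singular values of the `n × n` matrix `A`, counted with multiplicity, that lie
outside the `δ`-extension of `Φ` (the union of `Φ` and of the `δ`-balls centred at its points). -/
def singularOutliers {n : ℕ} (A : Matrix (Fin n) (Fin n) ℂ) (Φ : Set ℝ) (δ : ℝ) : ℕ :=
  {i : Fin n | (Matrix.toEuclideanLin A).singularValues i ∉ Metric.thickening δ Φ}.ncard

/-- `Φ` is a general cluster of the singular values of the matrix sequence `A`: for every `δ > 0`,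
the number of singular values of `A n` outside the `δ`-extension of `Φ` is `o(n)`. -/
def IsGeneralClusterSV (A : (n : ℕ) → Matrix (Fin n) (Fin n) ℂ) (Φ : Set ℝ) : Prop :=
  ∀ δ : ℝ, 0 < δ → Tendsto (fun n : ℕ => (singularOutliers (A n) Φ δ : ℝ) / n) atTop (𝓝 0)

end

/-!
The degrees may be chosen so large that `p` approximates `f` as closely as desired: the
trigonometric polynomials are uniformly dense in the continuous periodic functions, averaging over
`x ↦ -x` preserves the quality of an approximation, and a best approximation is at least as good as
any other (`exists_mem_evenTrigPolys_uniformError_le`, `exists_mem_oddTrigPolys_uniformError_le`).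

If `Re p ≥ μ > 0`, the form `⟨u, T_n(p) u⟩ = (1 / 2π) ∫ p |U|²` with `U = ∑ u_j e^{ijx}` has real
part at least `μ ‖u‖²`, so `T_n(p)` is invertible and `‖T_n(p)⁻¹‖ ≤ 1 / μ`, uniformly in `n`. Since
`T_n(p)⁻¹ T_n(f) - 1 = T_n(p)⁻¹ T_n(f - p)`, a uniform error `|f - p| ≤ η` puts every singular value
within `η / μ` of `1` (`norm_inv_mul_toeplitzMatrix_sub_le`, `abs_singularValues_sub_one_le`).
As `p₂ 0 = 0`, the constant `M` is at least `1 / p₁ 0`, which stays away from `0` as the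
approximation improves. For a close enough approximation `η / μ ≤ M ε`, so all singular values lie
in the interval and there are no outliers whatsoever.
-/

/-! ### Trigonometric polynomials -/

theorem IsTrigPoly.continuous {d : ℕ} {q : ℝ → ℝ} (h : IsTrigPoly d q) : Continuous q := by
  obtain ⟨a, b, hq⟩ := h
  rw [funext hq]
  fun_prop

theorem IsTrigPoly.periodic {d : ℕ} {q : ℝ → ℝ} (h : IsTrigPoly d q) :
    Function.Periodic q (2 * Real.pi) := by
  obtain ⟨a, b, hq⟩ := h
  intro x
  simp only [hq, mul_add, Real.cos_add_nat_mul_two_pi, Real.sin_add_nat_mul_two_pi]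

theorem IsTrigPoly.zero (d : ℕ) : IsTrigPoly d 0 := ⟨0, 0, fun x => by simp⟩

theorem IsTrigPoly.add {d : ℕ} {p q : ℝ → ℝ} (hp : IsTrigPoly d p) (hq : IsTrigPoly d q) :
    IsTrigPoly d (p + q) := by
  obtain ⟨a, b, hp⟩ := hp
  obtain ⟨a', b', hq⟩ := hq
  refine ⟨a + a', b + b', fun x => ?_⟩
  simp only [Pi.add_apply, hp, hq, ← Finset.sum_add_distrib]
  exact Finset.sum_congr rfl fun k _ => by ring

theorem IsTrigPoly.smul {d : ℕ} {q : ℝ → ℝ} (c : ℝ) (hq : IsTrigPoly d q) :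
    IsTrigPoly d (c • q) := by
  obtain ⟨a, b, hq⟩ := hq
  refine ⟨c • a, c • b, fun x => ?_⟩
  simp only [Pi.smul_apply, smul_eq_mul, hq, Finset.mul_sum]
  exact Finset.sum_congr rfl fun k _ => by ring

theorem IsTrigPoly.comp_neg {d : ℕ} {q : ℝ → ℝ} (hq : IsTrigPoly d q) :
    IsTrigPoly d (fun x => q (-x)) := by
  obtain ⟨a, b, hq⟩ := hq
  refine ⟨a, -b, fun x => ?_⟩
  simp [hq]

theorem IsTrigPoly.mono {d e : ℕ} {q : ℝ → ℝ} (hde : d ≤ e) (hq : IsTrigPoly d q) :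
    IsTrigPoly e q := by
  obtain ⟨a, b, hq⟩ := hq
  refine ⟨fun k => if k < d + 1 then a k else 0, fun k => if k < d + 1 then b k else 0,
    fun x => ?_⟩
  rw [hq, ← Finset.sum_subset (Finset.range_mono (Nat.succ_le_succ hde))]
  · refine Finset.sum_congr rfl fun k hk => ?_
    simp [Finset.mem_range.1 hk]
  · intro k _ hk
    simp [Finset.mem_range.not.1 hk]

theorem isTrigPoly_cos (d : ℕ) : IsTrigPoly d (fun x => Real.cos (d * x)) := by
  refine ⟨fun k => if k = d then 1 else 0, 0, fun x => ?_⟩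
  simp

theorem isTrigPoly_sin (d : ℕ) : IsTrigPoly d (fun x => Real.sin (d * x)) := by
  refine ⟨0, fun k => if k = d then 1 else 0, fun x => ?_⟩
  simp

/-- The real trigonometric polynomials of degree at most `d`, as a subspace. -/
def trigPolySubmodule (d : ℕ) : Submodule ℝ (ℝ → ℝ) where
  carrier := {q | IsTrigPoly d q}
  add_mem' := IsTrigPoly.add
  zero_mem' := IsTrigPoly.zero d
  smul_mem' c _ := IsTrigPoly.smul c

instance (d : ℕ) : FiniteDimensional ℝ (trigPolySubmodule d) := by
  let s : Set (ℝ → ℝ) := (fun k : ℕ => fun x : ℝ => Real.cos (k * x)) '' (Finset.range (d + 1)) ∪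
    (fun k : ℕ => fun x : ℝ => Real.sin (k * x)) '' (Finset.range (d + 1))
  have hs : s.Finite := (Set.toFinite _).union (Set.toFinite _)
  have : FiniteDimensional ℝ (Submodule.span ℝ s) := FiniteDimensional.span_of_finite ℝ hs
  refine Submodule.finiteDimensional_of_le (S₂ := Submodule.span ℝ s) ?_
  rintro q ⟨a, b, hq⟩
  have : q = ∑ k ∈ Finset.range (d + 1),
      (a k • (fun x : ℝ => Real.cos (k * x)) + b k • (fun x : ℝ => Real.sin (k * x))) := by
    ext x
    simp [hq]
  rw [this]
  refine Submodule.sum_mem _ fun k hk => Submodule.add_mem _ ?_ ?_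
  · exact Submodule.smul_mem _ _ (Submodule.subset_span (Or.inl ⟨k, hk, rfl⟩))
  · exact Submodule.smul_mem _ _ (Submodule.subset_span (Or.inr ⟨k, hk, rfl⟩))

/-- The even trigonometric polynomials of degree at most `d`, as a subspace. -/
def evenTrigPolySubmodule (d : ℕ) : Submodule ℝ (ℝ → ℝ) where
  carrier := evenTrigPolys d
  add_mem' h h' := ⟨h.1.add h'.1, h.2.add h'.2⟩
  zero_mem' := ⟨IsTrigPoly.zero d, fun _ => rfl⟩
  smul_mem' c _ h := ⟨h.1.smul c, fun x => congrArg (c * ·) (h.2 x)⟩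

/-- The odd trigonometric polynomials of degree at most `d`, as a subspace. -/
def oddTrigPolySubmodule (d : ℕ) : Submodule ℝ (ℝ → ℝ) where
  carrier := oddTrigPolys d
  add_mem' h h' := ⟨h.1.add h'.1, h.2.add h'.2⟩
  zero_mem' := ⟨IsTrigPoly.zero d, fun _ => by simp⟩
  smul_mem' c _ h := ⟨h.1.smul c, fun x => by simp [h.2 x]⟩

instance (d : ℕ) : FiniteDimensional ℝ (evenTrigPolySubmodule d) :=
  Submodule.finiteDimensional_of_le (S₂ := trigPolySubmodule d) fun _ h => h.1

instance (d : ℕ) : FiniteDimensional ℝ (oddTrigPolySubmodule d) :=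
  Submodule.finiteDimensional_of_le (S₂ := trigPolySubmodule d) fun _ h => h.1

/-! ### Best uniform approximation -/

theorem abs_sub_le_uniformError {g q : ℝ → ℝ} (hg : Continuous g) (hq : Continuous q) {x : ℝ}
    (hx : x ∈ Set.Icc (-Real.pi) Real.pi) : |g x - q x| ≤ uniformError g q :=
  le_csSup (isCompact_Icc.image (by fun_prop)).bddAbove ⟨x, hx, rfl⟩

theorem uniformError_le {g q : ℝ → ℝ} {c : ℝ}
    (h : ∀ x ∈ Set.Icc (-Real.pi) Real.pi, |g x - q x| ≤ c) : uniformError g q ≤ c :=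
  csSup_le ⟨_, -Real.pi, ⟨le_rfl, by linarith [Real.pi_pos]⟩, rfl⟩
    (by rintro _ ⟨x, hx, rfl⟩; exact h x hx)

/-- A finite-dimensional space of continuous functions contains a best uniform approximation of
any continuous function, since the distance to a point is coercive on it. -/
theorem exists_isBestUniformApprox (V : Submodule ℝ (ℝ → ℝ)) [FiniteDimensional ℝ V]
    (hV : ∀ q ∈ V, Continuous q) {g : ℝ → ℝ} (hg : Continuous g) :
    ∃ q, IsBestUniformApprox V g q := by
  let r : V →ₗ[ℝ] C(Set.Icc (-Real.pi) Real.pi, ℝ) :=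
    { toFun := fun q => ⟨fun x => (q : ℝ → ℝ) x, (hV q q.2).comp continuous_subtype_val⟩
      map_add' := fun _ _ => rfl
      map_smul' := fun _ _ => rfl }
  let g' : C(Set.Icc (-Real.pi) Real.pi, ℝ) := ⟨fun x => g x, hg.comp continuous_subtype_val⟩
  have hdist : ∀ q : V, ‖g' - r q‖ = uniformError g q := by
    intro q
    apply le_antisymm
    · refine (ContinuousMap.norm_le _ ?_).2 fun x => ?_
      · exact Real.sSup_nonneg (by rintro _ ⟨x, _, rfl⟩; exact abs_nonneg _)
      · exact abs_sub_le_uniformError hg (hV q q.2) x.2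
    · exact uniformError_le fun x hx => (g' - r q).norm_coe_le_norm ⟨x, hx⟩
  have : ProperSpace (LinearMap.range r) := FiniteDimensional.proper ℝ _
  have hcoercive : Tendsto (fun s : LinearMap.range r => ‖g' - s‖)
      (cocompact (LinearMap.range r)) atTop := by
    refine tendsto_atTop_mono (fun s => ?_)
      (tendsto_atTop_add_const_right _ (-‖g'‖) (tendsto_norm_cocompact_atTop))
    have := norm_sub_norm_le (s : C(Set.Icc (-Real.pi) Real.pi, ℝ)) g'
    rw [norm_sub_rev] at this
    simpa [sub_eq_add_neg] using this
  obtain ⟨⟨_, q, rfl⟩, hq⟩ := Continuous.exists_forall_le (by fun_prop) hcoercive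
  refine ⟨q, q.2, fun p hp => ?_⟩
  rw [← hdist q, ← hdist ⟨p, hp⟩]
  exact hq ⟨r ⟨p, hp⟩, ⟨p, hp⟩, rfl⟩

/-! ### Density of the trigonometric polynomials -/

/-- Real and imaginary parts are treated together because multiplication by a complex scalar mixes
them. -/
theorem exists_isTrigPoly_re_im_of_mem_span [Fact (0 < 2 * Real.pi)]
    {P : C(AddCircle (2 * Real.pi), ℂ)}
    (hP : P ∈ Submodule.span ℂ (Set.range (@fourier (2 * Real.pi)))) :
    ∃ d, IsTrigPoly d (fun x => (P (x : AddCircle (2 * Real.pi))).re) ∧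
      IsTrigPoly d (fun x => (P (x : AddCircle (2 * Real.pi))).im) := by
  induction hP using Submodule.span_induction with
  | mem P h =>
    obtain ⟨n, rfl⟩ := h
    have hexp : ∀ x : ℝ, fourier n (x : AddCircle (2 * Real.pi)) =
        Complex.exp ((n * x : ℝ) * Complex.I) := by
      intro x
      rw [fourier_coe_apply]
      congr 1
      have : (Real.pi : ℂ) ≠ 0 := by exact_mod_cast Real.pi_ne_zero
      push_cast
      field_simp
    simp only [hexp, Complex.exp_ofReal_mul_I_re, Complex.exp_ofReal_mul_I_im]
    refine ⟨n.natAbs, ?_⟩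
    obtain ⟨m, rfl | rfl⟩ := n.eq_nat_or_neg
    · simpa using ⟨isTrigPoly_cos m, isTrigPoly_sin m⟩
    · refine ⟨by simpa using isTrigPoly_cos m, ?_⟩
      simpa using (isTrigPoly_sin m).comp_neg
  | zero => exact ⟨0, IsTrigPoly.zero 0, IsTrigPoly.zero 0⟩
  | add P Q _ _ hP hQ =>
    obtain ⟨d, hd⟩ := hP
    obtain ⟨e, he⟩ := hQ
    exact ⟨max d e,
      (hd.1.mono (le_max_left _ _)).add (he.1.mono (le_max_right _ _)),
      (hd.2.mono (le_max_left _ _)).add (he.2.mono (le_max_right _ _))⟩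
  | smul c P _ hP =>
    obtain ⟨d, hre, him⟩ := hP
    refine ⟨d, ?_, ?_⟩
    · convert (hre.smul c.re).add (him.smul (-c.im)) using 1
      ext x
      simp
      ring
    · convert (him.smul c.re).add (hre.smul c.im) using 1
      ext x
      simp

theorem exists_isTrigPoly_abs_sub_le {g : ℝ → ℝ} (hg : Continuous g)
    (hper : Function.Periodic g (2 * Real.pi)) {η : ℝ} (hη : 0 < η) :
    ∃ d q, IsTrigPoly d q ∧ ∀ x, |g x - q x| ≤ η := by
  have : Fact (0 < 2 * Real.pi) := ⟨by positivity⟩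
  let G : C(AddCircle (2 * Real.pi), ℂ) :=
    ⟨fun y => ((hper.lift y : ℝ) : ℂ),
      Complex.continuous_ofReal.comp (continuous_coinduced_dom.mpr hg)⟩
  have hG : G ∈ (Submodule.span ℂ (Set.range (@fourier (2 * Real.pi)))).topologicalClosure := by
    rw [span_fourier_closure_eq_top]
    trivial
  obtain ⟨P, hP, hdist⟩ := Metric.mem_closure_iff.1 hG η hη
  obtain ⟨d, hre, -⟩ := exists_isTrigPoly_re_im_of_mem_span hP
  refine ⟨d, _, hre, fun x => ?_⟩
  have h1 := ContinuousMap.dist_apply_le_dist (f := G) (g := P) (x : AddCircle (2 * Real.pi))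
  have h2 := Complex.abs_re_le_norm (G (x : AddCircle (2 * Real.pi)) - P x)
  rw [dist_eq_norm] at h1
  exact (h2.trans h1).trans hdist.le

theorem exists_mem_evenTrigPolys_uniformError_le {g : ℝ → ℝ} (hg : Continuous g)
    (hper : Function.Periodic g (2 * Real.pi)) (heven : Function.Even g) {η : ℝ} (hη : 0 < η) :
    ∃ d, ∃ q ∈ evenTrigPolys d, uniformError g q ≤ η := by
  obtain ⟨d, q, hq, hgq⟩ := exists_isTrigPoly_abs_sub_le hg hper hη
  refine ⟨d, _, ⟨(hq.add hq.comp_neg).smul (1 / 2), fun x => ?_⟩, uniformError_le fun x _ => ?_⟩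
  · simp [add_comm]
  · have h1 := abs_le.1 (hgq x)
    have h2 := abs_le.1 (hgq (-x))
    rw [heven x] at h2
    simp only [Pi.smul_apply, Pi.add_apply, smul_eq_mul]
    exact abs_le.2 ⟨by linarith, by linarith⟩

theorem exists_mem_oddTrigPolys_uniformError_le {g : ℝ → ℝ} (hg : Continuous g)
    (hper : Function.Periodic g (2 * Real.pi)) (hodd : Function.Odd g) {η : ℝ} (hη : 0 < η) :
    ∃ d, ∃ q ∈ oddTrigPolys d, uniformError g q ≤ η := by
  obtain ⟨d, q, hq, hgq⟩ := exists_isTrigPoly_abs_sub_le hg hper hη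
  refine ⟨d, _, ⟨(hq.add (hq.comp_neg.smul (-1))).smul (1 / 2), fun x => ?_⟩,
    uniformError_le fun x _ => ?_⟩
  · simp
    ring
  · have h1 := abs_le.1 (hgq x)
    have h2 := abs_le.1 (hgq (-x))
    rw [hodd x] at h2
    simp only [Pi.smul_apply, Pi.add_apply, smul_eq_mul]
    exact abs_le.2 ⟨by linarith, by linarith⟩

/-! ### The quadratic form of a Toeplitz matrix -/

/-- The trigonometric polynomial `∑ j, v j * e^{i j x}` with coefficient vector `v`. -/
noncomputable def expPoly {n : ℕ} (v : Fin n → ℂ) (x : ℝ) : ℂ :=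
  ∑ j, v j * Complex.exp (Complex.I * ((j : ℕ) : ℂ) * (x : ℂ))

theorem continuous_expPoly {n : ℕ} (v : Fin n → ℂ) : Continuous (expPoly v) := by
  unfold expPoly
  fun_prop

theorem star_dotProduct_toeplitzMatrix_mulVec {n : ℕ} {g : ℝ → ℂ} (hg : Continuous g)
    (u v : Fin n → ℂ) :
    star u ⬝ᵥ (toeplitzMatrix g n).mulVec v =
      (1 / (2 * (Real.pi : ℂ))) *
        ∫ x in (-Real.pi)..Real.pi, g x * (star (expPoly u x) * expPoly v x) := by
  have hexpand : ∀ x : ℝ, g x * (star (expPoly u x) * expPoly v x) =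
      ∑ j, ∑ k, star (u j) * v k *
        (g x * Complex.exp (-Complex.I * (((j : ℕ) : ℂ) - ((k : ℕ) : ℂ)) * (x : ℂ))) := by
    intro x
    rw [expPoly, expPoly, star_sum, Finset.sum_mul_sum]
    simp only [Finset.mul_sum]
    refine Finset.sum_congr rfl fun j _ => Finset.sum_congr rfl fun k _ => ?_
    have : -Complex.I * (((j : ℕ) : ℂ) - ((k : ℕ) : ℂ)) * (x : ℂ) =
        star (Complex.I * ((j : ℕ) : ℂ) * (x : ℂ)) + Complex.I * ((k : ℕ) : ℂ) * (x : ℂ) := by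
      simp
      ring
    rw [this, Complex.exp_add, star_mul']
    simp only [RCLike.star_def, Complex.exp_conj]
    ring
  simp only [hexpand]
  rw [intervalIntegral.integral_finsetSum
    fun j _ => Continuous.intervalIntegrable (by fun_prop) _ _]
  simp only [dotProduct, Matrix.mulVec, Finset.mul_sum, Pi.star_apply]
  refine Finset.sum_congr rfl fun j _ => ?_
  rw [intervalIntegral.integral_finsetSum
    fun j _ => Continuous.intervalIntegrable (by fun_prop) _ _, Finset.mul_sum]
  refine Finset.sum_congr rfl fun k _ => ?_
  rw [intervalIntegral.integral_const_mul]
  simp only [toeplitzMatrix, Matrix.of_apply]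
  ring

theorem toeplitzMatrix_one (n : ℕ) : toeplitzMatrix (fun _ => 1) n = 1 := by
  have hpi : (Real.pi : ℂ) ≠ 0 := by exact_mod_cast Real.pi_ne_zero
  ext j k
  simp only [toeplitzMatrix, Matrix.of_apply, one_mul]
  by_cases hjk : j = k
  · subst hjk
    simp
    field_simp
    norm_num
  · have hne : ((j : ℕ) : ℂ) - ((k : ℕ) : ℂ) ≠ 0 := by
      rw [sub_ne_zero]
      exact_mod_cast fun h => hjk (Fin.ext h)
    rw [Matrix.one_apply_ne hjk, integral_exp_mul_complex (by simpa using hne)]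
    -- the primitive takes the same value at both ends, by `2π`-periodicity
    have : Complex.exp (-Complex.I * (((j : ℕ) : ℂ) - ((k : ℕ) : ℂ)) * (Real.pi : ℂ)) =
        Complex.exp (-Complex.I * (((j : ℕ) : ℂ) - ((k : ℕ) : ℂ)) * ((-Real.pi : ℝ) : ℂ)) := by
      refine Complex.exp_eq_exp_iff_exists_int.2 ⟨(k : ℤ) - (j : ℤ), ?_⟩
      push_cast
      ring
    rw [this]
    simp

/-- Parseval's identity for trigonometric polynomials. -/
theorem integral_norm_expPoly_sq {n : ℕ} (v : EuclideanSpace ℂ (Fin n)) :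
    ∫ x in (-Real.pi)..Real.pi, ‖expPoly v x‖ ^ 2 = 2 * Real.pi * ‖v‖ ^ 2 := by
  have hpi : (Real.pi : ℂ) ≠ 0 := by exact_mod_cast Real.pi_ne_zero
  have h := star_dotProduct_toeplitzMatrix_mulVec (n := n) (g := fun _ => 1) continuous_const v v
  rw [toeplitzMatrix_one, Matrix.one_mulVec] at h
  have hsq : ∀ z : ℂ, 1 * (star z * z) = ((‖z‖ ^ 2 : ℝ) : ℂ) := by
    intro z
    rw [one_mul, RCLike.star_def, Complex.conj_mul']
    push_cast
    rfl
  simp only [hsq, intervalIntegral.integral_ofReal] at h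
  have hv : star (v : Fin n → ℂ) ⬝ᵥ (v : Fin n → ℂ) = ((‖v‖ ^ 2 : ℝ) : ℂ) := by
    rw [EuclideanSpace.norm_sq_eq]
    simp only [dotProduct, Pi.star_apply]
    push_cast
    refine Finset.sum_congr rfl fun i _ => ?_
    rw [RCLike.star_def, Complex.conj_mul']
  rw [hv] at h
  field_simp at h
  have h' : ((2 * Real.pi * ‖v‖ ^ 2 : ℝ) : ℂ) =
    ((∫ x in (-Real.pi)..Real.pi, ‖expPoly v x‖ ^ 2 : ℝ) : ℂ) := by
    rw [← h]
    push_cast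
    ring
  exact_mod_cast h'.symm

/-- If `Re g ≥ μ` on `[-π, π]`, then the form of `T_n(g)` has real part at least `μ ‖u‖²`. -/
theorem mul_norm_sq_le_re_star_dotProduct_toeplitzMatrix {n : ℕ} {g : ℝ → ℂ} (hg : Continuous g) {μ : ℝ}
    (hμ : ∀ x ∈ Set.Icc (-Real.pi) Real.pi, μ ≤ (g x).re) (u : EuclideanSpace ℂ (Fin n)) :
    μ * ‖u‖ ^ 2 ≤ (star (u : Fin n → ℂ) ⬝ᵥ (toeplitzMatrix g n).mulVec u).re := by
  have hcu := continuous_expPoly (u : Fin n → ℂ)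
  have hre : (star (u : Fin n → ℂ) ⬝ᵥ (toeplitzMatrix g n).mulVec u).re =
      1 / (2 * Real.pi) * ∫ x in (-Real.pi)..Real.pi, (g x).re * ‖expPoly u x‖ ^ 2 := by
    rw [star_dotProduct_toeplitzMatrix_mulVec hg]
    have h1 : (1 / (2 * (Real.pi : ℂ))) = ((1 / (2 * Real.pi) : ℝ) : ℂ) := by push_cast; rfl
    rw [h1, Complex.re_ofReal_mul]
    congr 1
    have h2 := intervalIntegral.intervalIntegral_re (𝕜 := ℂ) (μ := MeasureTheory.volume)
      (f := fun x => g x * (star (expPoly u x) * expPoly u x)) (a := -Real.pi) (b := Real.pi)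
      (Continuous.intervalIntegrable (by fun_prop) _ _)
    refine Eq.trans h2.symm ?_
    congr 1
    ext x
    rw [RCLike.star_def, Complex.conj_mul', ← Complex.ofReal_pow]
    exact Complex.re_mul_ofReal _ _
  have hmono : ∫ x in (-Real.pi)..Real.pi, μ * ‖expPoly u x‖ ^ 2 ≤
      ∫ x in (-Real.pi)..Real.pi, (g x).re * ‖expPoly u x‖ ^ 2 := by
    refine intervalIntegral.integral_mono_on (by linarith [Real.pi_pos])
      (Continuous.intervalIntegrable (by fun_prop) _ _)
      (Continuous.intervalIntegrable (by fun_prop) _ _) fun x hx => ?_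
    exact mul_le_mul_of_nonneg_right (hμ x hx) (by positivity)
  rw [intervalIntegral.integral_const_mul, integral_norm_expPoly_sq] at hmono
  rw [hre, one_div, le_inv_mul_iff₀ (by positivity)]
  linarith

/-- If `|g| ≤ η` on `[-π, π]`, then the form of `T_n(g)` is bounded by `η ‖u‖ ‖v‖`; this is that
bound with the product `‖u‖ ‖v‖` split by the weighted arithmetic-geometric mean inequality. -/
theorem norm_star_dotProduct_toeplitzMatrix_le {n : ℕ} {g : ℝ → ℂ} (hg : Continuous g) {η : ℝ}
    (hη : ∀ x ∈ Set.Icc (-Real.pi) Real.pi, ‖g x‖ ≤ η) {t : ℝ} (ht : 0 < t)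
    (u v : EuclideanSpace ℂ (Fin n)) :
    ‖star (u : Fin n → ℂ) ⬝ᵥ (toeplitzMatrix g n).mulVec v‖ ≤
      η * ((t * ‖u‖ ^ 2 + t⁻¹ * ‖v‖ ^ 2) / 2) := by
  have hcu := continuous_expPoly (u : Fin n → ℂ)
  have hcv := continuous_expPoly (v : Fin n → ℂ)
  have hpi := Real.pi_pos
  have hη0 : 0 ≤ η := (norm_nonneg _).trans (hη 0 ⟨by linarith, hpi.le⟩)
  have hbound : ‖∫ x in (-Real.pi)..Real.pi, g x * (star (expPoly u x) * expPoly v x)‖ ≤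
      ∫ x in (-Real.pi)..Real.pi,
        (η * t / 2 * ‖expPoly u x‖ ^ 2 + η * t⁻¹ / 2 * ‖expPoly v x‖ ^ 2) := by
    refine intervalIntegral.norm_integral_le_of_norm_le (by linarith)
      (Eventually.of_forall fun x hx => ?_) (Continuous.intervalIntegrable (by fun_prop) _ _)
    rw [norm_mul, norm_mul, norm_star]
    have hamgm : ‖expPoly u x‖ * ‖expPoly v x‖ ≤
        (t * ‖expPoly u x‖ ^ 2 + t⁻¹ * ‖expPoly v x‖ ^ 2) / 2 := by
      have h := mul_nonneg (inv_pos.2 ht).le (sq_nonneg (t * ‖expPoly u x‖ - ‖expPoly v x‖))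
      have h' : t⁻¹ * (t * ‖expPoly u x‖ - ‖expPoly v x‖) ^ 2 = t * ‖expPoly u x‖ ^ 2 -
          2 * (‖expPoly u x‖ * ‖expPoly v x‖) + t⁻¹ * ‖expPoly v x‖ ^ 2 := by
        field_simp
        ring
      linarith
    calc ‖g x‖ * (‖expPoly u x‖ * ‖expPoly v x‖)
        ≤ η * ((t * ‖expPoly u x‖ ^ 2 + t⁻¹ * ‖expPoly v x‖ ^ 2) / 2) :=
          mul_le_mul (hη x ⟨hx.1.le, hx.2⟩) hamgm (by positivity) hη0
      _ = _ := by ring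
  rw [intervalIntegral.integral_add (Continuous.intervalIntegrable (by fun_prop) _ _)
      (Continuous.intervalIntegrable (by fun_prop) _ _), intervalIntegral.integral_const_mul,
    intervalIntegral.integral_const_mul, integral_norm_expPoly_sq,
    integral_norm_expPoly_sq] at hbound
  rw [star_dotProduct_toeplitzMatrix_mulVec hg, norm_mul]
  have hc : ‖(1 / (2 * (Real.pi : ℂ)))‖ = (2 * Real.pi)⁻¹ := by
    simp [abs_of_pos hpi]
  rw [hc, inv_mul_le_iff₀ (by positivity)]
  linarith

theorem toeplitzMatrix_sub {f g : ℝ → ℂ} (hf : Continuous f) (hg : Continuous g) (n : ℕ) :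
    toeplitzMatrix (fun x => f x - g x) n = toeplitzMatrix f n - toeplitzMatrix g n := by
  ext j k
  simp only [toeplitzMatrix, Matrix.of_apply, Matrix.sub_apply, sub_mul]
  rw [intervalIntegral.integral_sub (Continuous.intervalIntegrable (by fun_prop) _ _)
    (Continuous.intervalIntegrable (by fun_prop) _ _), mul_sub]

theorem isUnit_toeplitzMatrix {g : ℝ → ℂ} (hg : Continuous g) {μ : ℝ} (hμ0 : 0 < μ)
    (hμ : ∀ x ∈ Set.Icc (-Real.pi) Real.pi, μ ≤ (g x).re) (n : ℕ) :
    IsUnit (toeplitzMatrix g n) := by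
  rw [← Matrix.mulVec_injective_iff_isUnit]
  refine (injective_iff_map_eq_zero (toeplitzMatrix g n).mulVecLin).2 fun u hu => ?_
  have h := mul_norm_sq_le_re_star_dotProduct_toeplitzMatrix hg hμ (WithLp.toLp 2 u)
  rw [Matrix.mulVecLin_apply] at hu
  simp only [hu, dotProduct_zero, Complex.zero_re] at h
  have h0 : ‖WithLp.toLp 2 u‖ ^ 2 ≤ 0 := nonpos_of_mul_nonpos_right h hμ0
  have h1 : WithLp.toLp 2 u = 0 :=
    norm_eq_zero.1 (pow_eq_zero_iff two_ne_zero |>.1 (le_antisymm h0 (sq_nonneg _)))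
  simpa using h1

/-- With `u = T_n(g)⁻¹ T_n(f) v - v` one has `T_n(g) u = T_n(f - g) v`, and coercivity of `T_n(g)`
turns the bound on `f - g` into a bound on `u`. -/
theorem norm_inv_mul_toeplitzMatrix_sub_le {f g : ℝ → ℂ} (hf : Continuous f) (hg : Continuous g)
    {μ η : ℝ} (hμ0 : 0 < μ) (hη0 : 0 < η)
    (hμ : ∀ x ∈ Set.Icc (-Real.pi) Real.pi, μ ≤ (g x).re)
    (hη : ∀ x ∈ Set.Icc (-Real.pi) Real.pi, ‖f x - g x‖ ≤ η) (n : ℕ)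
    (v : EuclideanSpace ℂ (Fin n)) :
    ‖Matrix.toEuclideanLin ((toeplitzMatrix g n)⁻¹ * toeplitzMatrix f n) v - v‖ ≤
      η / μ * ‖v‖ := by
  set u := Matrix.toEuclideanLin ((toeplitzMatrix g n)⁻¹ * toeplitzMatrix f n) v - v with hu
  have hunit : IsUnit (toeplitzMatrix g n).det :=
    (Matrix.isUnit_iff_isUnit_det _).1 (isUnit_toeplitzMatrix hg hμ0 hμ n)
  have hTu : (toeplitzMatrix g n).mulVec (u : Fin n → ℂ) =
      (toeplitzMatrix (fun x => f x - g x) n).mulVec (v : Fin n → ℂ) := by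
    have huv : (u : Fin n → ℂ) =
        ((toeplitzMatrix g n)⁻¹ * toeplitzMatrix f n).mulVec (v : Fin n → ℂ) - v := rfl
    rw [huv, Matrix.mulVec_sub, Matrix.mulVec_mulVec, Matrix.mul_nonsing_inv_cancel_left _ _ hunit,
      toeplitzMatrix_sub hf hg, Matrix.sub_mulVec]
  have hlower := mul_norm_sq_le_re_star_dotProduct_toeplitzMatrix hg hμ u
  rw [hTu] at hlower
  -- the weight `μ / η` lets half of the coercivity absorb the term in `u`
  have hupper := norm_star_dotProduct_toeplitzMatrix_le (hf.sub hg) hη (div_pos hμ0 hη0) u v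
  have hmid := (Complex.re_le_norm
    (star (u : Fin n → ℂ) ⬝ᵥ (toeplitzMatrix (fun x => f x - g x) n).mulVec (v : Fin n → ℂ)))
  have key : μ * ‖u‖ ^ 2 ≤ η * ((μ / η * ‖u‖ ^ 2 + (μ / η)⁻¹ * ‖v‖ ^ 2) / 2) :=
    hlower.trans (hmid.trans hupper)
  have hsq : ‖u‖ ^ 2 ≤ (η / μ * ‖v‖) ^ 2 := by
    have e : η * ((μ / η * ‖u‖ ^ 2 + (μ / η)⁻¹ * ‖v‖ ^ 2) / 2) =
        μ * (‖u‖ ^ 2 + (η / μ * ‖v‖) ^ 2) / 2 := by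
      field_simp
    rw [e] at key
    have : μ * ‖u‖ ^ 2 ≤ μ * (η / μ * ‖v‖) ^ 2 := by linarith
    exact le_of_mul_le_mul_left this hμ0
  exact le_of_sq_le_sq hsq (by positivity)

/-! ### Singular values of a perturbation of the identity -/

theorem abs_singularValues_sub_one_le {E : Type*} [NormedAddCommGroup E] [InnerProductSpace ℂ E]
    [FiniteDimensional ℂ E] (A : E →ₗ[ℂ] E) {c : ℝ} (hA : ∀ v, ‖A v - v‖ ≤ c * ‖v‖) {i : ℕ}
    (hi : i < Module.finrank ℂ E) : |A.singularValues i - 1| ≤ c := by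
  obtain ⟨v, hv⟩ := (A.hasEigenvalue_adjoint_comp_self_sq_singularValues hi).exists_hasEigenvector
  have hv0 : 0 < ‖v‖ := norm_pos_iff.2 hv.2
  have hnorm : ‖A v‖ = A.singularValues i * ‖v‖ := by
    have h : inner ℂ (A v) (A v) = ((A.singularValues i * ‖v‖ : ℝ) : ℂ) ^ 2 := by
      rw [← LinearMap.adjoint_inner_left, ← LinearMap.comp_apply, hv.apply_eq_smul,
        inner_smul_left, inner_self_eq_norm_sq_to_K]
      simp [mul_pow]
    rw [inner_self_eq_norm_sq_to_K] at h
    have h' : ‖A v‖ ^ 2 = (A.singularValues i * ‖v‖) ^ 2 :=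
      Complex.ofReal_injective (by simpa using h)
    exact (sq_eq_sq₀ (norm_nonneg _) (mul_nonneg (A.singularValues_nonneg i) hv0.le)).1 h'
  have h := (abs_norm_sub_norm_le (A v) v).trans (hA v)
  rw [hnorm] at h
  have e : A.singularValues i * ‖v‖ - ‖v‖ = (A.singularValues i - 1) * ‖v‖ := by ring
  rw [e, abs_mul, abs_norm] at h
  exact le_of_mul_le_mul_right h hv0

theorem isGeneralClusterSV_of_norm_sub_le {A : (n : ℕ) → Matrix (Fin n) (Fin n) ℂ} {c r : ℝ}
    (hcr : c ≤ r) (hA : ∀ n (v : EuclideanSpace ℂ (Fin n)),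
      ‖Matrix.toEuclideanLin (A n) v - v‖ ≤ c * ‖v‖) :
    IsGeneralClusterSV A (Set.Icc (1 - r) (1 + r)) := by
  intro δ hδ
  have h0 : ∀ n, singularOutliers (A n) (Set.Icc (1 - r) (1 + r)) δ = 0 := by
    intro n
    refine (Set.ncard_eq_zero).2 (Set.eq_empty_of_forall_notMem fun i hi => hi ?_)
    apply Metric.self_subset_thickening hδ
    have h := abs_le.1 (abs_singularValues_sub_one_le _ (hA n) (i := i) (by simp))
    exact ⟨by linarith, by linarith⟩
  simp [h0]

/-! ### The approximating symbol -/

theorem continuous_complexSymbol {g₁ g₂ : ℝ → ℝ} (h₁ : Continuous g₁) (h₂ : Continuous g₂) :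
    Continuous (complexSymbol g₁ g₂) := by
  unfold complexSymbol
  fun_prop

theorem norm_complexSymbol_sub_le (f₁ f₂ p₁ p₂ : ℝ → ℝ) (x : ℝ) :
    ‖complexSymbol f₁ f₂ x - complexSymbol p₁ p₂ x‖ ≤ |f₁ x - p₁ x| + |f₂ x - p₂ x| := by
  have : complexSymbol f₁ f₂ x - complexSymbol p₁ p₂ x =
      ((f₁ x - p₁ x : ℝ) : ℂ) + Complex.I * ((f₂ x - p₂ x : ℝ) : ℂ) := by
    simp only [complexSymbol]
    push_cast
    ring
  rw [this]
  refine (norm_add_le _ _).trans ?_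
  simp [-Complex.ofReal_sub]

theorem theorem2p2p1 (f₁ f₂ : ℝ → ℝ)
    (hf₁_cont : Continuous f₁) (hf₂_cont : Continuous f₂)
    (hf₁_per : Function.Periodic f₁ (2 * Real.pi)) (hf₂_per : Function.Periodic f₂ (2 * Real.pi))
    (hf₁_pos : ∀ x, 0 < f₁ x) (hf₁_even : Function.Even f₁) (hf₂_odd : Function.Odd f₂)
    (ε : ℝ) (hε : 0 < ε) :
    ∃ d₁ d₂ : ℕ,
      (∃ p₁, IsBestUniformApprox (evenTrigPolys d₁) f₁ p₁) ∧
      (∃ p₂, IsBestUniformApprox (oddTrigPolys d₂) f₂ p₂) ∧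
      ∀ p₁ p₂ : ℝ → ℝ,
        IsBestUniformApprox (evenTrigPolys d₁) f₁ p₁ →
        IsBestUniformApprox (oddTrigPolys d₂) f₂ p₂ →
          (∀ x, p₁ x ^ 2 + p₂ x ^ 2 ≠ 0) ∧
          (∀ n, IsUnit (toeplitzMatrix (complexSymbol p₁ p₂) n)) ∧
          ∃ M : ℝ,
            IsGreatest ((fun x => (1 / (p₁ x ^ 2 + p₂ x ^ 2)) ^ (1 / 2 : ℝ)) ''
              Set.Icc (-Real.pi) Real.pi) M ∧
            IsGeneralClusterSV
              (fun n => (toeplitzMatrix (complexSymbol p₁ p₂) n)⁻¹ *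
                toeplitzMatrix (complexSymbol f₁ f₂) n)
              (Set.Icc (1 - M * ε) (1 + M * ε)) := by
  have hpi := Real.pi_pos
  have h0mem : (0 : ℝ) ∈ Set.Icc (-Real.pi) Real.pi := ⟨by linarith, hpi.le⟩
  obtain ⟨x₀, -, hx₀⟩ := isCompact_Icc.exists_isMinOn ⟨0, h0mem⟩ hf₁_cont.continuousOn
  set m := f₁ x₀ with hm
  have hm0 : 0 < m := hf₁_pos x₀
  have hmin : ∀ x ∈ Set.Icc (-Real.pi) Real.pi, m ≤ f₁ x := fun x hx => hx₀ hx
  have hf0 := hf₁_pos 0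
  -- `η ≤ m / 2` keeps `p₁ ≥ m / 2`, `η ≤ 1` gives `p₁ 0 ≤ f₁ 0 + 1`, hence `1 / (f₁ 0 + 1) ≤ M`,
  -- and the last bound makes the radius `2η / (m / 2)` at most `ε / (f₁ 0 + 1)`
  obtain ⟨η, hη0, hη1, hη2, hη3⟩ : ∃ η : ℝ, 0 < η ∧ η ≤ m / 2 ∧ η ≤ 1 ∧
      η ≤ m * (ε / (f₁ 0 + 1)) / 4 :=
    ⟨min (m / 2) (min 1 (m * (ε / (f₁ 0 + 1)) / 4)), by positivity, min_le_left _ _,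
      (min_le_right _ _).trans (min_le_left _ _), (min_le_right _ _).trans (min_le_right _ _)⟩
  obtain ⟨d₁, q₁, hq₁, herr₁⟩ :=
    exists_mem_evenTrigPolys_uniformError_le hf₁_cont hf₁_per hf₁_even hη0
  obtain ⟨d₂, q₂, hq₂, herr₂⟩ :=
    exists_mem_oddTrigPolys_uniformError_le hf₂_cont hf₂_per hf₂_odd hη0
  refine ⟨d₁, d₂,
    exists_isBestUniformApprox (evenTrigPolySubmodule d₁) (fun _ h => h.1.continuous) hf₁_cont,
    exists_isBestUniformApprox (oddTrigPolySubmodule d₂) (fun _ h => h.1.continuous) hf₂_cont,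
    fun p₁ p₂ hp₁ hp₂ => ?_⟩
  have hc₁ := hp₁.1.1.continuous
  have hc₂ := hp₂.1.1.continuous
  have hdiff₁ : ∀ x ∈ Set.Icc (-Real.pi) Real.pi, |f₁ x - p₁ x| ≤ η := fun x hx =>
    (abs_sub_le_uniformError hf₁_cont hc₁ hx).trans ((hp₁.2 q₁ hq₁).trans herr₁)
  have hdiff₂ : ∀ x ∈ Set.Icc (-Real.pi) Real.pi, |f₂ x - p₂ x| ≤ η := fun x hx =>
    (abs_sub_le_uniformError hf₂_cont hc₂ hx).trans ((hp₂.2 q₂ hq₂).trans herr₂)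
  have hlow : ∀ x ∈ Set.Icc (-Real.pi) Real.pi, m / 2 ≤ p₁ x := fun x hx => by
    linarith [hmin x hx, (abs_le.1 (hdiff₁ x hx)).2]
  have hpos : ∀ x, 0 < p₁ x := by
    intro x
    obtain ⟨y, hy, hxy⟩ := hp₁.1.1.periodic.exists_mem_Ioc Real.two_pi_pos x (-Real.pi)
    rw [hxy]
    linarith [hlow y ⟨hy.1.le, by linarith [hy.2]⟩]
  have hne : ∀ x, p₁ x ^ 2 + p₂ x ^ 2 ≠ 0 := fun x => by
    have := hpos x
    positivity
  have hsymb : ∀ x ∈ Set.Icc (-Real.pi) Real.pi, m / 2 ≤ (complexSymbol p₁ p₂ x).re :=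
    fun x hx => by simpa [complexSymbol] using hlow x hx
  have hcp := continuous_complexSymbol hc₁ hc₂
  have hcf := continuous_complexSymbol hf₁_cont hf₂_cont
  refine ⟨hne, isUnit_toeplitzMatrix hcp (half_pos hm0) hsymb, ?_⟩
  have hcont : Continuous fun x => (1 / (p₁ x ^ 2 + p₂ x ^ 2)) ^ (1 / 2 : ℝ) :=
    (continuous_const.div (by fun_prop) hne).rpow_const fun x => Or.inr (by norm_num)
  obtain ⟨M, hM⟩ := (isCompact_Icc.image hcont).exists_isGreatest
    (Set.Nonempty.image _ ⟨0, h0mem⟩)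
  refine ⟨M, hM, ?_⟩
  have hM0 : 1 / (f₁ 0 + 1) ≤ M := by
    refine le_trans ?_ (hM.2 ⟨0, h0mem, rfl⟩)
    have hp₂0 : p₂ 0 = 0 := hp₂.1.2.map_zero
    have hp₁0 : p₁ 0 ≤ f₁ 0 + 1 := by linarith [(abs_le.1 (hdiff₁ 0 h0mem)).1]
    have h1 : (1 / (p₁ 0 ^ 2 + p₂ 0 ^ 2)) ^ (1 / 2 : ℝ) = 1 / p₁ 0 := by
      rw [hp₂0, ← Real.sqrt_eq_rpow]
      simp [Real.sqrt_sq (hpos 0).le]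
    change _ ≤ (1 / (p₁ 0 ^ 2 + p₂ 0 ^ 2)) ^ (1 / 2 : ℝ)
    rw [h1]
    exact one_div_le_one_div_of_le (hpos 0) hp₁0
  have hradius : 2 * η / (m / 2) ≤ M * ε := by
    rw [div_le_iff₀ (half_pos hm0)]
    have h1 : ε / (f₁ 0 + 1) ≤ M * ε := by
      have := mul_le_mul_of_nonneg_right hM0 hε.le
      rwa [one_div_mul_eq_div] at this
    nlinarith
  refine isGeneralClusterSV_of_norm_sub_le hradius fun n v =>
    norm_inv_mul_toeplitzMatrix_sub_le hcf hcp (half_pos hm0) (by positivity) hsymb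
      (fun x hx => ?_) n v
  linarith [norm_complexSymbol_sub_le f₁ f₂ p₁ p₂ x, hdiff₁ x hx, hdiff₂ x hx]
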